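/- Let $k$ be an algebraically closed field of characteristic $0$ (for example $k=\mathbb{C}$), and let $n\ge 12$ be divisible by $4$. Let $a=(1\,2\,\cdots\,n)\in S_n$ be the standard $n$-cycle, $C_n=\langle a\rangle$, and let $S_{n-1}\subset S_n$ be the subgroup of permutations fixing the symbol $n$. For $x\in S_{n-1}$ and $b\in C_n$ let $x\rhd b\in C_n$ and $x\lhd b\in S_{n-1}$ be the unique elements with $xb=(x\rhd b)(x\lhd b)$. Let $J_n=k^{S_{n-1}}\# kC_n$ be the bismash product Hopf algebra of this matched pair. It has basis $p_x\# b$ $(x\in S_{n-1},\ b\in C_n)$, multiplication $(p_x\#b)(p_y\#c)=\delta_{y,\,x\lhd b}\,p_x\#bc$, unit $\sum_x p_x\#1$, counit $\varepsilon(p_x\#b)=\delta_{x,1}$, comultiplication $\Delta(p_x\#b)=\sum_{y}(p_{xy^{-1}}\#(y\rhd b))\otimes(p_y\#b)$ and antipode $S(p_x\#b)=p_{(x\lhd b)^{-1}}\#(x\rhd b)^{-1}$. The Frobenius–Schur indicator of a finite-dimensional $J_n$-module with character $\chi$ is $\nu(\chi)=\chi(\sum\Lambda_1\Lambda_2)$,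 where $\Lambda$ is the two-sided integral of $J_n$ with $\varepsilon(\Lambda)=1$ and $\Delta(\Lambda)=\sum\Lambda_1\otimes\Lambda_2$. Then $J_n$ has an irreducible representation of dimension $2$ with Frobenius–Schur indicator $-1$. More precisely, let $$x=(1\ 5\ 9\ \cdots\ n-3)(3\ 7\ 11\ \cdots\ n-1)\in S_{n-1},$$ and let $\zeta\in k$ be any primitive $\frac n2$-th root of unity. Then the stabilizer $F_x=\{b\in C_n\mid x\lhd b=x\}$ equals $\langle a^2\rangle$. Let $V$ be the one-dimensional representation of $F_x$ on which $a^2$ acts by $\zeta^{n/4}$. Then the induced $J_n$-module $\hat V=kC_n\otimes_{kF_x}V$, with action $(p_y\#b)\cdot(c\otimes v)=\delta_{y\lhd(bc),\,x}\,(bc\otimes v)$, is irreducible, has dimension $2$, and has indicator $-1$. -/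

import Mathlib

open scoped TensorProduct

noncomputable section

set_option linter.unusedSectionVars false
set_option linter.unusedSimpArgs false

universe u v w

/-- A matched pair of groups `(F, G, ▷, ◁)`: a left action `▷ : G × F → F` of the group `G` on the
set `F` and a right action `◁ : G × F → G` of the group `F` on the set `G`, subject to the two
compatibility conditions `x ▷ ab = (x ▷ a)((x ◁ a) ▷ b)` and `xy ◁ a = (x ◁ (y ▷ a))(y ◁ a)`. -/
structure MatchedPair (F : Type u) (G : Type v) [Group F] [Group G] where
  /-- `lact x a = x ▷ a` -/
  lact : G → F → F
  /-- `ract x a = x ◁ a` -/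
  ract : G → F → G
  one_lact : ∀ a, lact 1 a = a
  mul_lact : ∀ x y a, lact (x * y) a = lact x (lact y a)
  ract_one : ∀ x, ract x 1 = x
  ract_mul : ∀ x a b, ract x (a * b) = ract (ract x a) b
  lact_mul : ∀ x a b, lact x (a * b) = lact x a * lact (ract x a) b
  mul_ract : ∀ x y a, ract (x * y) a = ract x (lact y a) * ract y a

namespace MatchedPair

section Factorization

variable {L : Type u} [Group L] {F G : Subgroup L}

theorem complement_unique (h : Subgroup.IsComplement (F : Set L) (G : Set L)) {l : L} {a : F}
    {x : G} (hl : (a : L) * (x : L) = l) : h.equiv l = (a, x) := by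
  rw [← hl]
  exact h.equiv.apply_symm_apply (a, x)

/-- The matched pair of an exact factorization `L = FG`, `F ∩ G = 1`: for `x ∈ G` and `b ∈ F`, the
elements `x ▷ b ∈ F` and `x ◁ b ∈ G` are determined by `x b = (x ▷ b) (x ◁ b)`. -/
def ofIsComplement (h : Subgroup.IsComplement (F : Set L) (G : Set L)) : MatchedPair F G where
  lact x b := (h.equiv ((x : L) * (b : L))).1
  ract x b := (h.equiv ((x : L) * (b : L))).2
  one_lact a := by
    rw [complement_unique h (a := a) (x := 1) (by simp)]
  mul_lact x y a := by
    have h1 := h.equiv_fst_mul_equiv_snd ((y : L) * (a : L))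
    have h2 := h.equiv_fst_mul_equiv_snd ((x : L) * ((h.equiv ((y : L) * (a : L))).1 : L))
    rw [complement_unique h (l := ((x * y : G) : L) * (a : L))
      (a := (h.equiv ((x : L) * ((h.equiv ((y : L) * (a : L))).1 : L))).1)
      (x := (h.equiv ((x : L) * ((h.equiv ((y : L) * (a : L))).1 : L))).2 *
        (h.equiv ((y : L) * (a : L))).2)]
    rw [Subgroup.coe_mul, ← mul_assoc, h2, mul_assoc, h1, Subgroup.coe_mul, mul_assoc]
  ract_one x := by
    rw [complement_unique h (a := 1) (x := x) (by simp)]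
  ract_mul x a b := by
    have h1 := h.equiv_fst_mul_equiv_snd ((x : L) * (a : L))
    have h2 := h.equiv_fst_mul_equiv_snd (((h.equiv ((x : L) * (a : L))).2 : L) * (b : L))
    rw [complement_unique h (l := (x : L) * ((a * b : F) : L))
      (a := (h.equiv ((x : L) * (a : L))).1 *
        (h.equiv (((h.equiv ((x : L) * (a : L))).2 : L) * (b : L))).1)
      (x := (h.equiv (((h.equiv ((x : L) * (a : L))).2 : L) * (b : L))).2)]
    rw [Subgroup.coe_mul, mul_assoc, h2, ← mul_assoc, h1, Subgroup.coe_mul, mul_assoc]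
  lact_mul x a b := by
    have h1 := h.equiv_fst_mul_equiv_snd ((x : L) * (a : L))
    have h2 := h.equiv_fst_mul_equiv_snd (((h.equiv ((x : L) * (a : L))).2 : L) * (b : L))
    rw [complement_unique h (l := (x : L) * ((a * b : F) : L))
      (a := (h.equiv ((x : L) * (a : L))).1 *
        (h.equiv (((h.equiv ((x : L) * (a : L))).2 : L) * (b : L))).1)
      (x := (h.equiv (((h.equiv ((x : L) * (a : L))).2 : L) * (b : L))).2)]
    rw [Subgroup.coe_mul, mul_assoc, h2, ← mul_assoc, h1, Subgroup.coe_mul, mul_assoc]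
  mul_ract x y a := by
    have h1 := h.equiv_fst_mul_equiv_snd ((y : L) * (a : L))
    have h2 := h.equiv_fst_mul_equiv_snd ((x : L) * ((h.equiv ((y : L) * (a : L))).1 : L))
    rw [complement_unique h (l := ((x * y : G) : L) * (a : L))
      (a := (h.equiv ((x : L) * ((h.equiv ((y : L) * (a : L))).1 : L))).1)
      (x := (h.equiv ((x : L) * ((h.equiv ((y : L) * (a : L))).1 : L))).2 *
        (h.equiv ((y : L) * (a : L))).2)]
    rw [Subgroup.coe_mul, ← mul_assoc, h2, mul_assoc, h1, Subgroup.coe_mul, mul_assoc]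

end Factorization

variable {F : Type u} {G : Type v} [Group F] [Group G] (M : MatchedPair F G)

theorem lact_one (x : G) : M.lact x 1 = 1 := by
  have h := M.lact_mul x 1 1
  rw [mul_one, M.ract_one] at h
  exact left_eq_mul.mp h

theorem one_ract (a : F) : M.ract 1 a = 1 := by
  have h := M.mul_ract 1 1 a
  rw [mul_one, M.one_lact] at h
  exact left_eq_mul.mp h

theorem ract_ract_inv (x : G) (a : F) : M.ract (M.ract x a) a⁻¹ = x := by
  rw [← M.ract_mul, mul_inv_cancel, M.ract_one]

theorem ract_inv_ract (x : G) (a : F) : M.ract (M.ract x a⁻¹) a = x := by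
  rw [← M.ract_mul, inv_mul_cancel, M.ract_one]

theorem inv_ract (x : G) (a : F) : (M.ract x a)⁻¹ = M.ract x⁻¹ (M.lact x a) := by
  have h := M.mul_ract x⁻¹ x a
  rw [inv_mul_cancel, M.one_ract] at h
  exact (eq_inv_of_mul_eq_one_left h.symm).symm

theorem lact_inv (x : G) (a : F) : (M.lact x a)⁻¹ = M.lact (M.ract x a) a⁻¹ := by
  have h := M.lact_mul x a a⁻¹
  rw [mul_inv_cancel, M.lact_one] at h
  exact (eq_inv_of_mul_eq_one_right h.symm).symm

/-- The permutation `x ↦ x ◁ a` of the set `G`. -/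
def ractEquiv (a : F) : G ≃ G where
  toFun x := M.ract x a
  invFun x := M.ract x a⁻¹
  left_inv x := M.ract_ract_inv x a
  right_inv x := M.ract_inv_ract x a

/-- The stabilizer `F_x = {b ∈ F | x ◁ b = x}`. -/
def stab (x : G) : Subgroup F where
  carrier := {b | M.ract x b = x}
  mul_mem' {a b} ha hb := by
    simp only [Set.mem_ofPred_eq] at ha hb ⊢
    rw [M.ract_mul, ha, hb]
  one_mem' := M.ract_one x
  inv_mem' {a} ha := by
    simp only [Set.mem_ofPred_eq] at ha ⊢
    conv_lhs => rw [← ha]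
    exact M.ract_ract_inv x a

/-- The underlying vector space `k^G ⊗ kF` of the bismash product `k^G # kF`, written as the free
vector space on the set of symbols `p_x # a`, for `x ∈ G` and `a ∈ F`. -/
@[nolint unusedArguments]
def Bismash (_M : MatchedPair F G) (k : Type w) [Field k] : Type (max u v w) := (G × F) →₀ k

namespace Bismash

variable (k : Type w) [Field k]

instance : AddCommGroup (M.Bismash k) := inferInstanceAs (AddCommGroup ((G × F) →₀ k))

instance : Module k (M.Bismash k) := inferInstanceAs (Module k ((G × F) →₀ k))

/-- The basis element `p_x # a` of `k^G # kF`. -/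
def basisElt (x : G) (a : F) : M.Bismash k := Finsupp.single (x, a) (1 : k)

variable {M k}

@[elab_as_elim]
theorem induction_on {P : M.Bismash k → Prop} (h : M.Bismash k) (h0 : P 0)
    (hadd : ∀ f g, P f → P g → P (f + g)) (hs : ∀ (c : k) x a, P (c • basisElt M k x a)) : P h := by
  refine Finsupp.induction_linear (motive := P) h h0 hadd fun s c => ?_
  have h1 : (c • basisElt M k s.1 s.2 : M.Bismash k) = (Finsupp.single s c : (G × F) →₀ k) :=
    (Finsupp.smul_single c s (1 : k)).trans (by rw [smul_eq_mul, mul_one])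
  have h2 := hs c s.1 s.2
  rw [h1] at h2
  exact h2

variable (M k) in
/-- The linear map out of `k^G # kF` with prescribed values on the elements `p_x # a`. -/
def lift {N : Type*} [AddCommGroup N] [Module k N] (f : G → F → N) : M.Bismash k →ₗ[k] N :=
  Finsupp.linearCombination k (fun s : G × F => f s.1 s.2)

@[simp]
theorem lift_basisElt {N : Type*} [AddCommGroup N] [Module k N] (f : G → F → N) (x : G) (a : F) :
    lift M k f (basisElt M k x a) = f x a := by
  have := Finsupp.linearCombination_single k (v := fun s : G × F => f s.1 s.2) (1 : k) (x, a)
  rw [one_smul] at this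
  exact this

theorem hom_ext {N : Type*} [AddCommMonoid N] [Module k N] {f g : M.Bismash k →ₗ[k] N}
    (h : ∀ x a, f (basisElt M k x a) = g (basisElt M k x a)) : f = g := by
  refine LinearMap.ext fun z => ?_
  induction z using induction_on with
  | h0 => simp
  | hadd f g hf hg => simp [hf, hg]
  | hs c x a => simp [h]

variable [DecidableEq G]

variable (M k) in
/-- Multiplication: `(p_x # a)(p_y # b) = δ_{y, x ◁ a} p_x # ab`. -/
def mulMap : M.Bismash k →ₗ[k] M.Bismash k →ₗ[k] M.Bismash k :=
  lift M k fun x a => lift M k fun y b =>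
    if y = M.ract x a then basisElt M k x (a * b) else 0

instance : Mul (M.Bismash k) := ⟨fun f g => mulMap M k f g⟩

theorem mul_def (f g : M.Bismash k) : f * g = mulMap M k f g := rfl

theorem basisElt_mul (x y : G) (a b : F) : basisElt M k x a * basisElt M k y b =
    if y = M.ract x a then basisElt M k x (a * b) else 0 := by
  simp [mul_def, mulMap]

variable [Fintype G]

/-- The unit `1 # 1`, where `1 = ∑ p_x` in `k^G`. -/
instance : One (M.Bismash k) := ⟨∑ x : G, basisElt M k x 1⟩

theorem one_def : (1 : M.Bismash k) = ∑ x : G, basisElt M k x 1 := rfl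

instance : Ring (M.Bismash k) :=
  { (inferInstance : AddCommGroup (M.Bismash k)) with
    mul := (· * ·)
    one := 1
    left_distrib := fun f g h => by simp [mul_def]
    right_distrib := fun f g h => by simp [mul_def]
    zero_mul := fun f => by simp [mul_def]
    mul_zero := fun f => by simp [mul_def]
    mul_assoc := fun f g h => by
      induction f using induction_on with
      | h0 => simp [mul_def]
      | hadd f f' hf hf' => simp only [mul_def, map_add, LinearMap.add_apply] at *; rw [hf, hf']
      | hs c x a =>
      induction g using induction_on with
      | h0 => simp [mul_def]
      | hadd f f' hf hf' => simp only [mul_def, map_add, LinearMap.add_apply] at *; rw [hf, hf']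
      | hs c' y b =>
      induction h using induction_on with
      | h0 => simp [mul_def]
      | hadd f f' hf hf' => simp only [mul_def, map_add, LinearMap.add_apply] at *; rw [hf, hf']
      | hs c'' z d =>
      simp only [mul_def, mulMap, map_smul, LinearMap.smul_apply, lift_basisElt]
      split_ifs with h1 h2 h2
      · simp only [map_smul, LinearMap.smul_apply, lift_basisElt]
        rw [if_pos h1, if_pos (by rw [h2, h1, M.ract_mul]), mul_assoc]
      · simp only [map_smul, LinearMap.smul_apply, lift_basisElt, smul_zero, map_zero]
        rw [if_neg (by rw [M.ract_mul, ← h1]; exact h2)]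
        simp
      · simp only [map_smul, LinearMap.smul_apply, lift_basisElt, smul_zero, map_zero,
          LinearMap.zero_apply]
        rw [if_neg h1]
        simp
      · simp
    one_mul := fun f => by
      induction f using induction_on with
      | h0 => simp [mul_def]
      | hadd f f' hf hf' => simp only [mul_def, map_add] at *; rw [hf, hf']
      | hs c x a => simp [mul_def, one_def, mulMap, M.ract_one]
    mul_one := fun f => by
      induction f using induction_on with
      | h0 => simp [mul_def]
      | hadd f f' hf hf' => simp only [mul_def, map_add, LinearMap.add_apply] at *; rw [hf, hf']
      | hs c x a => simp [mul_def, one_def, mulMap] }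

instance : Algebra k (M.Bismash k) :=
  Algebra.ofModule (fun c f g => by simp [mul_def]) (fun c f g => by simp [mul_def])

variable (M k) in
/-- Counit: `ε(p_x # a) = δ_{x, 1}`. -/
def counitMap : M.Bismash k →ₗ[k] k := lift M k fun x _ => if x = 1 then 1 else 0

variable (M k) in
/-- Comultiplication: `Δ(p_x # a) = ∑_y (p_{xy⁻¹} # (y ▷ a)) ⊗ (p_y # a)`. -/
def comulMap : M.Bismash k →ₗ[k] M.Bismash k ⊗[k] M.Bismash k :=
  lift M k fun x a => ∑ y : G, basisElt M k (x * y⁻¹) (M.lact y a) ⊗ₜ[k] basisElt M k y a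

variable (M k) in
/-- Antipode: `S(p_x # a) = p_{(x ◁ a)⁻¹} # (x ▷ a)⁻¹`. -/
def antipodeMap : M.Bismash k →ₗ[k] M.Bismash k :=
  lift M k fun x a => basisElt M k (M.ract x a)⁻¹ (M.lact x a)⁻¹

instance : Coalgebra k (M.Bismash k) where
  comul := comulMap M k
  counit := counitMap M k
  coassoc := hom_ext fun x a => by
    simp only [LinearMap.comp_apply, comulMap, lift_basisElt, map_sum, LinearMap.rTensor_tmul,
      LinearMap.lTensor_tmul, TensorProduct.sum_tmul, TensorProduct.tmul_sum,
      LinearEquiv.coe_coe, TensorProduct.assoc_tmul]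
    conv_rhs => rw [Finset.sum_comm]
    refine Finset.sum_congr rfl fun y _ => ?_
    refine Fintype.sum_equiv (Equiv.mulRight y) _ _ fun z => ?_
    simp [M.mul_lact, mul_assoc]
  rTensor_counit_comp_comul := hom_ext fun x a => by
    simp [comulMap, counitMap, mul_inv_eq_one, TensorProduct.ite_tmul]
  lTensor_counit_comp_comul := hom_ext fun x a => by
    simp [comulMap, counitMap, M.one_lact, TensorProduct.tmul_ite]

theorem comul_basisElt (x : G) (a : F) : Coalgebra.comul (R := k) (basisElt M k x a) =
    ∑ y : G, basisElt M k (x * y⁻¹) (M.lact y a) ⊗ₜ[k] basisElt M k y a := by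
  exact lift_basisElt _ x a

theorem counit_basisElt (x : G) (a : F) :
    Coalgebra.counit (R := k) (basisElt M k x a) = if x = 1 then 1 else 0 :=
  lift_basisElt _ x a

theorem ract_eq_one_iff (x : G) (a : F) : M.ract x a = 1 ↔ x = 1 :=
  ⟨fun h => by rw [← M.ract_ract_inv x a, h, M.one_ract], fun h => by rw [h, M.one_ract]⟩

theorem ract_mul_inv (x y : G) (a : F) :
    M.ract (x * y⁻¹) (M.lact y a) = M.ract x a * (M.ract y a)⁻¹ := by
  have h := M.mul_ract (x * y⁻¹) y a
  rw [inv_mul_cancel_right] at h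
  exact eq_mul_inv_of_mul_eq h.symm

theorem counit_basisElt_mul (x y : G) (a b : F) :
    Coalgebra.counit (R := k) (basisElt M k x a * basisElt M k y b) =
      Coalgebra.counit (R := k) (basisElt M k x a) *
        Coalgebra.counit (R := k) (basisElt M k y b) := by
  rw [basisElt_mul, counit_basisElt, counit_basisElt]
  by_cases hx : x = 1
  · subst hx
    by_cases hy : y = 1 <;> simp [M.one_ract, hy, counit_basisElt]
  · split_ifs with h1 <;> simp [counit_basisElt, hx]

theorem comul_basisElt_mul (x y : G) (a b : F) :
    Coalgebra.comul (R := k) (basisElt M k x a * basisElt M k y b) =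
      Coalgebra.comul (R := k) (basisElt M k x a) *
        Coalgebra.comul (R := k) (basisElt M k y b) := by
  rw [basisElt_mul, comul_basisElt, comul_basisElt, Finset.sum_mul_sum]
  have key : ∀ z w : G, (basisElt M k (x * z⁻¹) (M.lact z a) ⊗ₜ[k] basisElt M k z a) *
      (basisElt M k (y * w⁻¹) (M.lact w b) ⊗ₜ[k] basisElt M k w b) =
      if w = M.ract z a then (if y = M.ract x a then
        basisElt M k (x * z⁻¹) (M.lact z (a * b)) ⊗ₜ[k] basisElt M k z (a * b) else 0) else 0 := by
    intro z w
    rw [Algebra.TensorProduct.tmul_mul_tmul, basisElt_mul, basisElt_mul]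
    split_ifs with h1 h2 h3 h3 h2
    · rw [M.lact_mul, h2]
    · rw [ract_mul_inv, h2] at h1
      exact absurd (mul_right_cancel h1) h3
    · simp
    · rw [ract_mul_inv, h2, h3] at h1
      exact absurd rfl h1
    · simp
    · simp
  simp only [key, Finset.sum_ite_eq', Finset.mem_univ, if_true]
  split_ifs with h1
  · rw [comul_basisElt]
  · simp

instance : Bialgebra k (M.Bismash k) :=
  Bialgebra.mk' k (M.Bismash k)
    (by simp [one_def, counit_basisElt])
    (fun {f g} => by
      induction f using induction_on with
      | h0 => simp
      | hadd f f' hf hf' => simp only [add_mul, map_add, hf, hf']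
      | hs c x a =>
      induction g using induction_on with
      | h0 => simp
      | hadd f f' hf hf' => simp only [mul_add, map_add, hf, hf']
      | hs c' y b => simp only [smul_mul_assoc, mul_smul_comm, map_smul, counit_basisElt_mul])
    (by
      rw [one_def, map_sum, Algebra.TensorProduct.one_def, one_def, TensorProduct.sum_tmul]
      simp only [comul_basisElt, M.lact_one, TensorProduct.tmul_sum]
      rw [Finset.sum_comm]
      conv_rhs => rw [Finset.sum_comm]
      refine Finset.sum_congr rfl fun y _ => ?_
      exact Fintype.sum_equiv (Equiv.mulRight y⁻¹) _ _ fun z => by simp)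
    (fun {f g} => by
      induction f using induction_on with
      | h0 => simp
      | hadd f f' hf hf' => simp only [add_mul, map_add, hf, hf']
      | hs c x a =>
      induction g using induction_on with
      | h0 => simp
      | hadd f f' hf hf' => simp only [mul_add, map_add, hf, hf']
      | hs c' y b => simp only [smul_mul_assoc, mul_smul_comm, map_smul, comul_basisElt_mul])

instance : HopfAlgebra k (M.Bismash k) where
  antipode := antipodeMap M k
  mul_antipode_rTensor_comul := hom_ext fun x a => by
    simp only [LinearMap.comp_apply, comul_basisElt, counit_basisElt, map_sum,
      LinearMap.rTensor_tmul, antipodeMap, lift_basisElt, LinearMap.mul'_apply, basisElt_mul,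
      Algebra.linearMap_apply]
    by_cases hx : x = 1
    · subst hx
      simp only [one_mul, if_true, map_one]
      rw [one_def]
      refine Fintype.sum_equiv (M.ractEquiv a) _ _ fun y => ?_
      have h1 : M.lact y⁻¹ (M.lact y a) = a := by
        rw [← M.mul_lact, inv_mul_cancel, M.one_lact]
      have h2 : (M.ract y⁻¹ (M.lact y a))⁻¹ = M.ract y a := by
        rw [← M.inv_ract, inv_inv]
      rw [h1, h2, if_pos (M.ract_ract_inv y a).symm, inv_mul_cancel]
      rfl
    · simp only [hx, if_false, map_zero]
      refine Finset.sum_eq_zero fun y _ => if_neg fun h => hx ?_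
      rw [M.inv_ract, M.ract_ract_inv, mul_inv_rev, inv_inv] at h
      exact inv_eq_one.mp (left_eq_mul.mp h)
  mul_antipode_lTensor_comul := hom_ext fun x a => by
    simp only [LinearMap.comp_apply, comul_basisElt, counit_basisElt, map_sum,
      LinearMap.lTensor_tmul, antipodeMap, lift_basisElt, LinearMap.mul'_apply, basisElt_mul,
      Algebra.linearMap_apply, ract_mul_inv, right_eq_mul, ract_eq_one_iff, mul_inv_cancel]
    by_cases hx : x = 1
    · subst hx
      simp only [one_mul, if_true, map_one]
      rw [one_def]
      exact Fintype.sum_equiv (Equiv.inv G) _ _ fun y => rfl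
    · simp [hx]

end Bismash

section Induced

variable {k : Type w} [Field k] {V : Type*} [AddCommGroup V] [Module k V]
variable (x : G) (ρ : Representation k (M.stab x) V)

/-- The relations `bh ⊗ v = b ⊗ hv` (`b ∈ F`, `h ∈ F_x`, `v ∈ V`) that define `kF ⊗_{kF_x} V` as a
quotient of `kF ⊗_k V`. The latter is written as `F →₀ V`, with `b ⊗ v = Finsupp.single b v`. -/
def balancedRel : Submodule k (F →₀ V) :=
  Submodule.span k {w | ∃ (b : F) (h : M.stab x) (v : V),
    w = Finsupp.single (b * (h : F)) v - Finsupp.single b (ρ h v)}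

/-- The vector space `kF ⊗_{kF_x} V`. -/
def Induced : Type _ := (F →₀ V) ⧸ M.balancedRel x ρ

instance : AddCommGroup (M.Induced x ρ) := inferInstanceAs (AddCommGroup (_ ⧸ M.balancedRel x ρ))

instance : Module k (M.Induced x ρ) := inferInstanceAs (Module k (_ ⧸ M.balancedRel x ρ))

variable [DecidableEq G]

variable (k V) in
/-- The action `(p_y # a) · (b ⊗ v) = δ_{y ◁ (ab), x} (ab ⊗ v)` on `kF ⊗_k V`. -/
def actMap : M.Bismash k →ₗ[k] Module.End k (F →₀ V) :=
  Bismash.lift M k fun y a => Finsupp.lsum k fun b =>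
    if M.ract y (a * b) = x then Finsupp.lsingle (a * b) else 0

theorem actMap_basisElt (y : G) (a b : F) (v : V) :
    M.actMap k V x (Bismash.basisElt M k y a) (Finsupp.single b v) =
      if M.ract y (a * b) = x then Finsupp.single (a * b) v else 0 := by
  rw [actMap, Bismash.lift_basisElt, Finsupp.lsum_single]
  split_ifs <;> simp

theorem actMap_mem (f : M.Bismash k) :
    M.balancedRel x ρ ≤ (M.balancedRel x ρ).comap (M.actMap k V x f) := by
  refine Submodule.span_le.mpr ?_
  rintro _ ⟨b, h, v, rfl⟩
  induction f using Bismash.induction_on with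
  | h0 => simp
  | hadd f g hf hg =>
    simp only [SetLike.mem_coe, Submodule.mem_comap, map_add, LinearMap.add_apply] at *
    exact add_mem hf hg
  | hs c y a =>
    simp only [SetLike.mem_coe, Submodule.mem_comap, map_smul, LinearMap.smul_apply, map_sub]
    rw [← smul_sub]
    refine Submodule.smul_mem _ c ?_
    rw [actMap_basisElt, actMap_basisElt]
    have hx : M.ract x (h : F) = x := h.2
    have hiff : M.ract y (a * (b * (h : F))) = x ↔ M.ract y (a * b) = x := by
      rw [← mul_assoc, M.ract_mul]
      constructor
      · intro h1
        exact (M.ractEquiv (h : F)).injective (h1.trans hx.symm)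
      · intro h1
        rw [h1, hx]
    by_cases h1 : M.ract y (a * b) = x
    · rw [if_pos h1, if_pos (hiff.mpr h1), ← mul_assoc]
      exact Submodule.subset_span ⟨a * b, h, v, rfl⟩
    · rw [if_neg h1, if_neg (fun h2 => h1 (hiff.mp h2)), sub_zero]
      exact zero_mem _

variable [Fintype G]

theorem actMap_one : M.actMap k V x 1 = 1 := by
  refine Finsupp.lhom_ext fun b v => ?_
  have h1 : M.actMap k V x 1 = ∑ y : G, M.actMap k V x (Bismash.basisElt M k y 1) := by
    rw [Bismash.one_def, map_sum]
  rw [h1, LinearMap.sum_apply]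
  simp only [actMap_basisElt, one_mul, Module.End.one_apply]
  rw [Finset.sum_eq_single (M.ract x b⁻¹)]
  · rw [M.ract_inv_ract, if_pos rfl]
  · intro y _ hy
    refine if_neg fun h => hy ?_
    rw [← h, M.ract_ract_inv]
  · simp

theorem actMap_mul (f g : M.Bismash k) :
    M.actMap k V x (f * g) = M.actMap k V x f * M.actMap k V x g := by
  induction f using Bismash.induction_on with
  | h0 => simp
  | hadd f f' hf hf' => simp only [add_mul, map_add, hf, hf']
  | hs c y a =>
  induction g using Bismash.induction_on with
  | h0 => simp
  | hadd f f' hf hf' => simp only [mul_add, map_add, hf, hf']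
  | hs c' z d =>
  simp only [smul_mul_assoc, mul_smul_comm, map_smul]
  congr 2
  refine Finsupp.lhom_ext fun b v => ?_
  rw [Module.End.mul_apply, Bismash.basisElt_mul, actMap_basisElt]
  by_cases h1 : z = M.ract y a
  · subst h1
    rw [if_pos rfl, actMap_basisElt, ← M.ract_mul, mul_assoc]
    by_cases h2 : M.ract y (a * (d * b)) = x
    · rw [if_pos h2, if_pos h2, actMap_basisElt, if_pos h2]
    · rw [if_neg h2, if_neg h2, map_zero]
  · rw [if_neg h1]
    by_cases h2 : M.ract z (d * b) = x
    · rw [if_pos h2, actMap_basisElt, if_neg]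
      · simp
      · intro h3
        rw [M.ract_mul] at h3
        exact h1 ((M.ractEquiv (d * b)).injective (h2.trans h3.symm))
    · rw [if_neg h2]
      simp

/-- The action of `k^G # kF` on `kF ⊗_{kF_x} V` given by
`(p_y # a) · (b ⊗ v) = δ_{y ◁ (ab), x} (ab ⊗ v)`. -/
def inducedAction : M.Bismash k →ₐ[k] Module.End k (M.Induced x ρ) :=
  AlgHom.ofLinearMap
    { toFun := fun f => (M.balancedRel x ρ).mapQ (M.balancedRel x ρ) (M.actMap k V x f)
        (M.actMap_mem x ρ f)
      map_add' := fun f g => by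
        refine Submodule.linearMap_qext _ (LinearMap.ext fun w => ?_)
        simp only [map_add]
        rfl
      map_smul' := fun c f => by
        refine Submodule.linearMap_qext _ (LinearMap.ext fun w => ?_)
        simp only [map_smul]
        rfl }
    (by
      refine Submodule.linearMap_qext _ (LinearMap.ext fun w => ?_)
      exact congrArg (M.balancedRel x ρ).mkQ (LinearMap.congr_fun (M.actMap_one (k := k) x) w))
    (fun f g => by
      refine Submodule.linearMap_qext _ (LinearMap.ext fun w => ?_)
      exact congrArg (M.balancedRel x ρ).mkQ (LinearMap.congr_fun (M.actMap_mul x f g) w))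

/-- The `k^G # kF`-module `kF ⊗_{kF_x} V` induced from `x ∈ G` and a representation `V` of `F_x`. -/
instance : Module (M.Bismash k) (M.Induced x ρ) :=
  Module.compHom (M.Induced x ρ) (M.inducedAction x ρ).toRingHom

theorem bismash_smul_def (f : M.Bismash k) (w : M.Induced x ρ) :
    f • w = M.inducedAction x ρ f w := rfl

instance : IsScalarTower k (M.Bismash k) (M.Induced x ρ) where
  smul_assoc c f w := by
    rw [bismash_smul_def, bismash_smul_def, map_smul, LinearMap.smul_apply]

end Induced

end MatchedPair

section Indicator

variable (k : Type u) {H : Type v} [Field k] [Ring H] [HopfAlgebra k H]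

/-- `Λ` is a two-sided integral of the Hopf algebra `H`, normalized by `ε(Λ) = 1`. -/
structure IsNormalizedIntegral (Λ : H) : Prop where
  left : ∀ h : H, h * Λ = Coalgebra.counit (R := k) h • Λ
  right : ∀ h : H, Λ * h = Coalgebra.counit (R := k) h • Λ
  counit_eq_one : Coalgebra.counit (R := k) Λ = 1

variable {k} in
theorem IsNormalizedIntegral.unique {Λ Λ' : H} (h : IsNormalizedIntegral k Λ)
    (h' : IsNormalizedIntegral k Λ') : Λ = Λ' := by
  have h1 := h.right Λ'
  rw [h'.left Λ, h.counit_eq_one, h'.counit_eq_one, one_smul, one_smul] at h1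
  exact h1.symm

/-- The character of an `H`-module: `χ(h)` is the trace of `h` acting on `V`. -/
def hopfCharacter (V : Type w) [AddCommGroup V] [Module k V] [Module H V] [IsScalarTower k H V]
    (h : H) : k :=
  LinearMap.trace k V (Algebra.lsmul k k V h)

variable (H) in
/-- The (second) Frobenius-Schur indicator of the `H`-module `V` is equal to `c`:
`χ(∑ Λ₁ Λ₂) = c`, where `χ` is the character of `V`, `Λ` is the (unique) two-sided integral of `H`
with `ε(Λ) = 1`, and `Δ(Λ) = ∑ Λ₁ ⊗ Λ₂`. -/
def HasIndicator (V : Type w) [AddCommGroup V] [Module k V] [Module H V] [IsScalarTower k H V]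
    (c : k) : Prop :=
  ∃ Λ : H, IsNormalizedIntegral k Λ ∧
    hopfCharacter k V (LinearMap.mul' k H (Coalgebra.comul (R := k) Λ)) = c

end Indicator

section SymmetricGroup

/-- The standard `n`-cycle `a = (1 2 ⋯ n)`, viewed as the permutation `m ↦ m + 1` of `ℤ/n`. Here
and below, the symbols `1, …, n` stand for their residue classes, so that `n` stands for `0`. -/
def stdCycle (n : ℕ) : Equiv.Perm (ZMod n) := Equiv.addRight 1

/-- `C_n`, the subgroup of `S_n` generated by the standard `n`-cycle. -/
abbrev cyclicSubgroup (n : ℕ) : Subgroup (Equiv.Perm (ZMod n)) := Subgroup.zpowers (stdCycle n)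

/-- `S_{n-1}`, the subgroup of the permutations in `S_n` that fix the symbol `n` (that is, `0`). -/
abbrev fixSubgroup (n : ℕ) : Subgroup (Equiv.Perm (ZMod n)) :=
  MulAction.stabilizer (Equiv.Perm (ZMod n)) (0 : ZMod n)

/-- The standard `n`-cycle as an element of `C_n`. -/
def cyclicGen (n : ℕ) : cyclicSubgroup n := ⟨stdCycle n, Subgroup.mem_zpowers _⟩

theorem stdCycle_zpow_apply (n : ℕ) (i : ℤ) (m : ZMod n) : (stdCycle n ^ i) m = m + i := by
  induction i generalizing m with
  | zero => simp
  | succ i ih =>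
    rw [zpow_add_one, Equiv.Perm.mul_apply, ih]
    simp only [stdCycle, Equiv.coe_addRight]
    push_cast
    ring
  | pred i ih =>
    rw [zpow_sub_one, Equiv.Perm.mul_apply, ih]
    simp only [stdCycle, Equiv.Perm.inv_def, Equiv.addRight_symm, Equiv.coe_addRight]
    push_cast
    ring

theorem isComplement_cyclic_fix (n : ℕ) : Subgroup.IsComplement
    (cyclicSubgroup n : Set (Equiv.Perm (ZMod n))) (fixSubgroup n : Set (Equiv.Perm (ZMod n))) := by
  refine Subgroup.isComplement'_stabilizer (0 : ZMod n) ?_ ?_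
  · rintro ⟨_, i, rfl⟩ h
    have h1 : (stdCycle n ^ i) 0 = 0 := h
    refine Subtype.ext (Equiv.ext fun m => ?_)
    rw [stdCycle_zpow_apply, zero_add] at h1
    exact (stdCycle_zpow_apply n i m).trans (by rw [h1, add_zero]; rfl)
  · intro g
    obtain ⟨i, hi⟩ := ZMod.intCast_surjective (-(g 0))
    refine ⟨⟨stdCycle n ^ i, i, rfl⟩, (stdCycle_zpow_apply n i (g 0)).trans ?_⟩
    rw [hi, add_neg_cancel]

/-- The matched pair of `C_n` and `S_{n-1}` coming from the factorization `S_n = C_n S_{n-1}`. -/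
def symMatchedPair (n : ℕ) : MatchedPair (cyclicSubgroup n) (fixSubgroup n) :=
  MatchedPair.ofIsComplement (isComplement_cyclic_fix n)

/-- The bismash product Hopf algebra `J_n = k^{S_{n-1}} # kC_n`. -/
abbrev BismashSym (k : Type w) [Field k] (n : ℕ) : Type w := (symMatchedPair n).Bismash k

/-- The permutation `(1 5 9 ⋯ n-3)(3 7 11 ⋯ n-1)` of the symbols `1, …, n`, for `n` divisible
by `4`. -/
def stepFourPerm (n : ℕ) : Equiv.Perm (ZMod n) :=
  ((List.range (n / 4)).map fun i => ((4 * i + 1 : ℕ) : ZMod n)).formPerm *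
    ((List.range (n / 4)).map fun i => ((4 * i + 3 : ℕ) : ZMod n)).formPerm

end SymmetricGroup

end

/-! On residues mod `n`, `x` fixes the even classes and adds `4` to the odd ones. Hence `x` commutes
with `a ^ 2` and `x a x = a ^ 5`. Uniqueness of the factorization turns these identities into the
matched-pair action: even powers of `a` fix `x` and `x⁻¹`, while odd powers exchange them, with `x ▷
a^(2i+1) = a^(2i+5)` and `x⁻¹ ▷ a^(2i+1) = a^(2i-3)`. Since `x⁻¹ ≠ x` for `n ≥ 12`, the stabilizer
is `⟨a ^ 2⟩`, of index `2`, and this is the dimension. Simplicity holds for every module induced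
from a one-dimensional representation (`isSimpleModule_induced`).

For the indicator, `Λ = n⁻¹ ∑ p_1 # b`, and the product `Λ₁Λ₂` can be computed one `b` at a time. On
`c ⊗ v` only the summand with `y = (x ◁ c⁻¹)⁻¹` can act, and it does so only if `y ◁ b = y⁻¹`; the
result is then `(y ▷ b) b c ⊗ v`. Here `y` is `x` or `x⁻¹`, so even `b` give zero. For odd `b` the
factor `(y ▷ b) b` is an odd power of `a ^ 2`, which acts by `ζ ^ (n / 4) = -1`. Half of the `b` are
odd, so `Λ₁Λ₂` acts as the scalar `-1/2`, and its trace in dimension `2` is `-1`. The lemmas that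
carry this are `mul_comul_smul_tmul`, `act_stepFour_odd` and `mul_comul_smul_tmul_stepFour`. -/

noncomputable section

universe u v w

/-! ### Reading the actions off a factorization -/

namespace MatchedPair

variable {F : Type u} {G : Type v} [Group F] [Group G] (M : MatchedPair F G)

theorem ract_eq_iff (x y : G) (b : F) : M.ract y b = x ↔ y = M.ract x b⁻¹ :=
  ⟨fun h => by rw [← h, M.ract_ract_inv], fun h => by rw [h, M.ract_inv_ract]⟩

/-- Lets the case split on the stabilizer be rewritten as a condition on `◁`. -/
theorem mem_stab (x : G) (b : F) : b ∈ M.stab x ↔ M.ract x b = x := Iff.rfl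

/-- Factorizations are unique, so a single identity in the ambient group determines both actions.
All later values of `▷` and `◁` on `x` come from here. -/
theorem ofIsComplement_apply {L : Type u} [Group L] {F G : Subgroup L}
    (h : Subgroup.IsComplement (F : Set L) (G : Set L)) {x y : G} {b c : F}
    (hxb : (x : L) * (b : L) = (c : L) * (y : L)) :
    (ofIsComplement h).lact x b = c ∧ (ofIsComplement h).ract x b = y := by
  have h1 := complement_unique h hxb.symm
  exact ⟨congrArg Prod.fst h1, congrArg Prod.snd h1⟩

/-! ### The normalized integral and the product of its two tensor legs -/

namespace Bismash

variable (k : Type w) [Field k] [DecidableEq G] [Fintype G]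

/-- The element `|F|⁻¹ ∑_b p_1 # b`. -/
def integral [Fintype F] : M.Bismash k := (Fintype.card F : k)⁻¹ • ∑ b : F, basisElt M k 1 b

/-- The product with `p_1 # b` survives only if `x ◁ a = 1`, that is `x = 1`; in that case left
translation by `a` permutes the sum. -/
theorem basisElt_mul_sum [Fintype F] (x : G) (a : F) :
    basisElt M k x a * ∑ b : F, basisElt M k 1 b =
      Coalgebra.counit (R := k) (basisElt M k x a) • ∑ b : F, basisElt M k 1 b := by
  rw [Finset.mul_sum, counit_basisElt]
  simp only [basisElt_mul, eq_comm (a := (1 : G)), ract_eq_one_iff]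
  by_cases hx : x = 1
  · subst hx
    simp only [if_true, one_smul]
    exact Fintype.sum_equiv (Equiv.mulLeft a) _ _ fun b => rfl
  · simp [hx]

theorem sum_mul_basisElt [Fintype F] (x : G) (a : F) :
    (∑ b : F, basisElt M k 1 b) * basisElt M k x a =
      Coalgebra.counit (R := k) (basisElt M k x a) • ∑ b : F, basisElt M k 1 b := by
  rw [Finset.sum_mul, counit_basisElt]
  simp only [basisElt_mul, M.one_ract]
  by_cases hx : x = 1
  · simp only [hx, if_true, one_smul]
    exact Fintype.sum_equiv (Equiv.mulRight a) _ _ fun b => rfl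
  · simp [hx]

theorem isNormalizedIntegral_integral [Fintype F] (hF : (Fintype.card F : k) ≠ 0) :
    IsNormalizedIntegral k (integral M k) where
  left h := by
    induction h using induction_on with
    | h0 => simp
    | hadd f g hf hg => simp only [add_mul, map_add, add_smul, hf, hg]
    | hs c x a =>
      rw [integral, smul_mul_assoc, mul_smul_comm, basisElt_mul_sum, map_smul, smul_assoc,
        smul_comm _ (Coalgebra.counit (R := k) (basisElt M k x a))]
  right h := by
    induction h using induction_on with
    | h0 => simp
    | hadd f g hf hg => simp only [mul_add, map_add, add_smul, hf, hg]
    | hs c x a =>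
      rw [integral, mul_smul_comm, smul_mul_assoc, sum_mul_basisElt, map_smul, smul_assoc,
        smul_comm _ (Coalgebra.counit (R := k) (basisElt M k x a))]
  counit_eq_one := by
    simp [integral, counit_basisElt, hF]

/-- The legs `p_{y⁻¹} # (y ▷ b)` and `p_y # b` multiply to something nonzero exactly when `y = y⁻¹ ◁
(y ▷ b)`, and the right side is `(y ◁ b)⁻¹`. -/
theorem mul_comul_basisElt_one (b : F) :
    LinearMap.mul' k (M.Bismash k) (Coalgebra.comul (R := k) (basisElt M k 1 b)) =
      ∑ y : G, if M.ract y b = y⁻¹ then basisElt M k y⁻¹ (M.lact y b * b) else 0 := by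
  rw [comul_basisElt, map_sum]
  refine Finset.sum_congr rfl fun y _ => ?_
  rw [LinearMap.mul'_apply, basisElt_mul, one_mul, ← M.inv_ract]
  simp only [eq_inv_iff_mul_eq_one, eq_comm (a := y), inv_eq_iff_eq_inv]

end Bismash

/-! ### Induced modules: coset coordinates, dimension, simplicity -/

section Induced

variable {k : Type w} [Field k] {V : Type*} [AddCommGroup V] [Module k V]
variable (x : G) (ρ : Representation k (M.stab x) V)

/-- The tensor `b ⊗ v` in `kF ⊗_{kF_x} V`. -/
def inducedTmul (b : F) : V →ₗ[k] M.Induced x ρ :=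
  (M.balancedRel x ρ).mkQ ∘ₗ Finsupp.lsingle b

theorem inducedTmul_mul (b : F) (h : M.stab x) (v : V) :
    M.inducedTmul x ρ (b * h) v = M.inducedTmul x ρ b (ρ h v) :=
  (Submodule.Quotient.eq _).mpr (Submodule.subset_span ⟨b, h, v, rfl⟩)

theorem induced_hom_ext {N : Type*} [AddCommGroup N] [Module k N] {f g : M.Induced x ρ →ₗ[k] N}
    (h : ∀ b v, f (M.inducedTmul x ρ b v) = g (M.inducedTmul x ρ b v)) : f = g :=
  Submodule.linearMap_qext _ (Finsupp.lhom_ext h)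

/-- For `b ∈ F`, the element `h ∈ F_x` such that `b = c h`, where `c` is the chosen representative
of the coset `b F_x`. -/
def stabPart (b : F) : M.stab x :=
  ⟨(b : F ⧸ M.stab x).out⁻¹ * b, QuotientGroup.eq.mp (QuotientGroup.out_eq' _)⟩

theorem out_mul_stabPart (b : F) : (b : F ⧸ M.stab x).out * (M.stabPart x b : F) = b :=
  mul_inv_cancel_left _ _

theorem stabPart_mul (b : F) (h : M.stab x) : M.stabPart x (b * h) = M.stabPart x b * h := by
  refine Subtype.ext ?_
  have : ((b * h : F) : F ⧸ M.stab x) = b := QuotientGroup.mk_mul_of_mem b h.2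
  simp only [stabPart, this, Subgroup.coe_mul, mul_assoc]

theorem stabPart_out (i : F ⧸ M.stab x) : M.stabPart x i.out = 1 := by
  refine Subtype.ext ?_
  simp [stabPart]

open Classical in
/-- The coordinates of an element of `kF ⊗_{kF_x} V` with respect to representatives of the left
cosets of `F_x`. -/
def inducedCoord : M.Induced x ρ →ₗ[k] (F ⧸ M.stab x → V) :=
  (M.balancedRel x ρ).liftQ
    (Finsupp.lsum k fun b => LinearMap.single k (fun _ => V) (b : F ⧸ M.stab x) ∘ₗ
      -- The map respects the balancing relations because `stabPart` turns right multiplication by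
      -- `h ∈ F_x` into multiplication by `h`, while the coset stays the same.
      ρ (M.stabPart x b)) (by
    refine Submodule.span_le.mpr ?_
    rintro _ ⟨b, h, v, rfl⟩
    have : ((b * h : F) : F ⧸ M.stab x) = b := QuotientGroup.mk_mul_of_mem b h.2
    rw [SetLike.mem_coe, LinearMap.mem_ker, map_sub, Finsupp.lsum_single, Finsupp.lsum_single,
      LinearMap.comp_apply, LinearMap.comp_apply, this, stabPart_mul, map_mul, Module.End.mul_apply,
      sub_self])

open Classical in
theorem inducedCoord_tmul (b : F) (v : V) : M.inducedCoord x ρ (M.inducedTmul x ρ b v) =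
    Pi.single (b : F ⧸ M.stab x) (ρ (M.stabPart x b) v) :=
  Finsupp.lsum_single (R := k) (S := k) _ _ _

/-- As a vector space, `kF ⊗_{kF_x} V` is a direct sum of copies of `V` indexed by the left cosets
of `F_x`. -/
def inducedEquiv [Fintype (F ⧸ M.stab x)] : M.Induced x ρ ≃ₗ[k] (F ⧸ M.stab x → V) :=
  LinearEquiv.ofLinearMap (M.inducedCoord x ρ)
    (∑ i : F ⧸ M.stab x, M.inducedTmul x ρ i.out ∘ₗ LinearMap.proj i)
    (by
      classical
      refine LinearMap.pi_ext fun i v => ?_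
      simp only [LinearMap.comp_apply, LinearMap.sum_apply, LinearMap.proj_apply, LinearMap.id_apply]
      rw [Finset.sum_eq_single i]
      · simp [inducedCoord_tmul, stabPart_out]
      · intro j _ hj
        simp [hj]
      · simp)
    (by
      classical
      refine M.induced_hom_ext x ρ fun b v => ?_
      simp only [LinearMap.comp_apply, LinearMap.sum_apply, LinearMap.proj_apply,
        LinearMap.id_apply, inducedCoord_tmul]
      rw [Finset.sum_eq_single (b : F ⧸ M.stab x)]
      · rw [Pi.single_eq_same, ← inducedTmul_mul, out_mul_stabPart]
      · intro j _ hj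
        simp [hj]
      · simp)

theorem inducedEquiv_symm_apply [Fintype (F ⧸ M.stab x)] (f : F ⧸ M.stab x → V) :
    (M.inducedEquiv x ρ).symm f = ∑ i, M.inducedTmul x ρ i.out (f i) := by
  change (∑ i : F ⧸ M.stab x, M.inducedTmul x ρ i.out ∘ₗ LinearMap.proj i) f = _
  simp

theorem finrank_induced [Finite F] (ρ : Representation k (M.stab x) k) :
    Module.finrank k (M.Induced x ρ) = (M.stab x).index := by
  have := Fintype.ofFinite (F ⧸ M.stab x)
  rw [(M.inducedEquiv x ρ).finrank_eq, Module.finrank_fintype_fun_eq_card, Subgroup.index,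
    Nat.card_eq_fintype_card]

variable [DecidableEq G] [Fintype G]

theorem basisElt_smul_tmul (y : G) (a b : F) (v : V) :
    Bismash.basisElt M k y a • M.inducedTmul x ρ b v =
      if M.ract y (a * b) = x then M.inducedTmul x ρ (a * b) v else 0 := by
  have h : Bismash.basisElt M k y a • M.inducedTmul x ρ b v =
      (M.balancedRel x ρ).mkQ (M.actMap k V x (Bismash.basisElt M k y a) (Finsupp.single b v)) :=
    rfl
  rw [h, actMap_basisElt]
  split_ifs
  · rfl
  · exact map_zero _

/-- The index of `p` is chosen so that the action on coset `j` survives only if `i.out⁻¹ * j.out`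
fixes `x`, that is `j = i`. The element therefore isolates one coordinate and translates it by `b`.
-/
theorem basisElt_smul_inducedEquiv_symm [Fintype (F ⧸ M.stab x)] (f : F ⧸ M.stab x → V)
    (i : F ⧸ M.stab x) (b : F) : Bismash.basisElt M k (M.ract x (b * i.out)⁻¹) b •
      (M.inducedEquiv x ρ).symm f = M.inducedTmul x ρ (b * i.out) (f i) := by
  rw [inducedEquiv_symm_apply, Finset.smul_sum, Finset.sum_eq_single i]
  · rw [basisElt_smul_tmul, M.ract_inv_ract, if_pos rfl]
  · intro j _ hj
    rw [basisElt_smul_tmul, if_neg]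
    rw [← M.ract_mul, mul_inv_rev, mul_assoc, inv_mul_cancel_left]
    intro h
    have h1 : i.out⁻¹ * j.out ∈ M.stab x := h
    have h2 := QuotientGroup.eq.mpr h1
    rw [QuotientGroup.out_eq', QuotientGroup.out_eq'] at h2
    exact hj h2.symm
  · simp

/-- A nonzero vector has a nonzero coordinate. That coordinate is a scalar, so it can be isolated,
rescaled and moved to any coset; the vector thus generates the whole module. -/
theorem isSimpleModule_induced [Finite F] (ρ : Representation k (M.stab x) k) :
    IsSimpleModule (M.Bismash k) (M.Induced x ρ) := by
  have := Fintype.ofFinite (F ⧸ M.stab x)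
  have : Nontrivial (M.Induced x ρ) := (M.inducedEquiv x ρ).toEquiv.nontrivial
  refine isSimpleModule_iff_toSpanSingleton_surjective.mpr ⟨inferInstance, fun w hw => ?_⟩
  obtain ⟨f, rfl⟩ := (M.inducedEquiv x ρ).symm.surjective w
  obtain ⟨i, hi⟩ : ∃ i, f i ≠ 0 := by
    by_contra! h
    exact hw (by rw [show f = 0 from funext h, map_zero])
  intro z
  obtain ⟨g, rfl⟩ := (M.inducedEquiv x ρ).symm.surjective z
  -- The `j`-th term carries coordinate `i` to coset `j` and rescales it from `f i` to `g j`.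
  refine ⟨∑ j, (g j / f i) • Bismash.basisElt M k (M.ract x (j.out * i.out⁻¹ * i.out)⁻¹)
    (j.out * i.out⁻¹), ?_⟩
  rw [LinearMap.toSpanSingleton_apply, Finset.sum_smul, inducedEquiv_symm_apply M x ρ g]
  refine Finset.sum_congr rfl fun j _ => ?_
  rw [smul_assoc, basisElt_smul_inducedEquiv_symm, inv_mul_cancel_right, ← map_smul, smul_eq_mul,
    div_mul_cancel₀ _ hi]

/-- If `y ◁ b = y⁻¹`, then `y⁻¹ ◁ ((y ▷ b) b) = y⁻¹`, so the term indexed by `y` acts on `c ⊗ v`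
only if `y⁻¹ ◁ c = x`. This singles out one `y`. -/
theorem mul_comul_smul_tmul (b c : F) (v : V) :
    LinearMap.mul' k (M.Bismash k) (Coalgebra.comul (R := k) (Bismash.basisElt M k 1 b)) •
      M.inducedTmul x ρ c v =
      if M.ract (M.ract x c⁻¹)⁻¹ b = M.ract x c⁻¹ then
        M.inducedTmul x ρ (M.lact (M.ract x c⁻¹)⁻¹ b * b * c) v else 0 := by
  rw [Bismash.mul_comul_basisElt_one, Finset.sum_smul,
    Finset.sum_eq_single (M.ract x c⁻¹)⁻¹]
  · rw [inv_inv]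
    split_ifs with h
    · rw [basisElt_smul_tmul, if_pos]
      have h1 := M.inv_ract (M.ract x c⁻¹)⁻¹ b
      rw [h, inv_inv] at h1
      rw [M.ract_mul, M.ract_mul, ← h1, h, M.ract_inv_ract]
    · exact zero_smul _ _
  · intro y _ hy
    split_ifs with h
    · rw [basisElt_smul_tmul, if_neg]
      have h1 := M.inv_ract y b
      rw [h, inv_inv] at h1
      rw [M.ract_mul, M.ract_mul, ← h1, h, M.ract_eq_iff]
      exact fun h2 => hy (by rw [← h2, inv_inv])
    · exact zero_smul _ _
  · simp

end Induced
end MatchedPair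

/-! ### Indicators from scalar actions -/

theorem hasIndicator_of_lsmul_eq (k : Type u) {H : Type v} [Field k] [Ring H] [HopfAlgebra k H]
    (V : Type w) [AddCommGroup V] [Module k V] [Module H V] [IsScalarTower k H V]
    [Module.Finite k V] {Λ : H} (hΛ : IsNormalizedIntegral k Λ) (c : k)
    (h : Algebra.lsmul k k V (LinearMap.mul' k H (Coalgebra.comul (R := k) Λ)) =
      c • LinearMap.id) :
    HasIndicator k H V (c * Module.finrank k V) := by
  refine ⟨Λ, hΛ, ?_⟩
  rw [hopfCharacter, h, map_smul, LinearMap.trace_id, smul_eq_mul]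

/-! ### The permutation `x` on residues, and its relations with `a` -/

theorem ZMod.two_mul_ne_two_mul_add_one {n : ℕ} (h2 : 2 ∣ n) (s t : ZMod n) :
    2 * s ≠ 2 * t + 1 := by
  intro h
  have h1 := congrArg (ZMod.castHom h2 (ZMod 2)) h
  simp only [map_mul, map_add, map_ofNat, map_one] at h1
  rw [show (2 : ZMod 2) = 0 from rfl] at h1
  simp at h1

theorem ZMod.eq_two_mul_or {n : ℕ} (m : ZMod n) : ∃ t : ZMod n, m = 2 * t ∨ m = 2 * t + 1 := by
  obtain ⟨i, rfl⟩ := ZMod.intCast_surjective m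
  obtain ⟨j, rfl | rfl⟩ := Int.even_or_odd' i
  · exact ⟨j, Or.inl (by push_cast; rfl)⟩
  · exact ⟨j, Or.inr (by push_cast; rfl)⟩

theorem nodup_map_four_mul_add {n : ℕ} (h4 : 4 ∣ n) {c : ℕ} (hc : c < 4) :
    ((List.range (n / 4)).map fun i => ((4 * i + c : ℕ) : ZMod n)).Nodup := by
  refine List.Nodup.map_on (fun i hi j hj h => ?_) List.nodup_range
  rw [List.mem_range] at hi hj
  rw [ZMod.natCast_eq_natCast_iff', Nat.mod_eq_of_lt (by omega), Nat.mod_eq_of_lt (by omega)] at h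
  omega

theorem formPerm_four_mul_add {n : ℕ} (h4 : 4 ∣ n) {c : ℕ} (hc : c < 4) {i : ℕ} (hi : i < n / 4) :
    ((List.range (n / 4)).map fun i => ((4 * i + c : ℕ) : ZMod n)).formPerm
      ((4 * i + c : ℕ) : ZMod n) = ((4 * i + c : ℕ) : ZMod n) + 4 := by
  have h := List.formPerm_apply_getElem _ (nodup_map_four_mul_add h4 hc) i (by simpa using hi)
  simp only [List.getElem_map, List.getElem_range, List.length_map, List.length_range] at h
  rw [h]
  rcases Nat.lt_or_ge (i + 1) (n / 4) with h1 | h1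
  · rw [Nat.mod_eq_of_lt h1]
    push_cast
    ring
  -- At the last entry the cycle returns to `c`, which agrees with adding `4` because `4 * i + c + 4
  -- = c + n`.
  · have h2 : i + 1 = n / 4 := by omega
    have h3 : 4 * i + c + 4 = c + n := by omega
    rw [h2, Nat.mod_self]
    have h4 := congrArg (Nat.cast (R := ZMod n)) h3
    push_cast at h4 ⊢
    rw [h4]
    simp

theorem formPerm_four_mul_add_of_ne {n : ℕ} (h4 : 4 ∣ n) {c d : ℕ} (hc : c < 4) (hd : d < 4)
    (hcd : c ≠ d) (i : ℕ) :
    ((List.range (n / 4)).map fun i => ((4 * i + c : ℕ) : ZMod n)).formPerm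
      ((4 * i + d : ℕ) : ZMod n) = ((4 * i + d : ℕ) : ZMod n) := by
  refine List.formPerm_apply_of_notMem fun h => hcd ?_
  obtain ⟨j, -, hj⟩ := List.mem_map.mp h
  rw [ZMod.natCast_eq_natCast_iff] at hj
  have h1 : (4 * j + c) % 4 = (4 * i + d) % 4 := hj.of_dvd h4
  omega

theorem exists_eq_four_mul_add {n : ℕ} [NeZero n] (h4 : 4 ∣ n) (m : ZMod n) :
    ∃ i c : ℕ, c < 4 ∧ i < n / 4 ∧ m = ((4 * i + c : ℕ) : ZMod n) := by
  refine ⟨m.val / 4, m.val % 4, by omega, ?_, ?_⟩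
  · have := m.val_lt
    omega
  · rw [Nat.div_add_mod, ZMod.natCast_zmod_val]

/-- The two cycles run through the classes `1` and `3` mod `4`, each in steps of `4`. Only parity
matters afterwards, so all later identities are checked on `2 * t` and `2 * t + 1`. -/
theorem stepFourPerm_apply {n : ℕ} [NeZero n] (h4 : 4 ∣ n) (t : ZMod n) :
    stepFourPerm n (2 * t) = 2 * t ∧ stepFourPerm n (2 * t + 1) = 2 * t + 1 + 4 := by
  have h2 : 2 ∣ n := Dvd.dvd.trans (by norm_num) h4
  constructor
  · obtain ⟨i, c, hc, hi, h⟩ := exists_eq_four_mul_add h4 (2 * t)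
    have hodd : ∀ d, c ≠ 2 * d + 1 := by
      rintro d rfl
      refine ZMod.two_mul_ne_two_mul_add_one h2 t (2 * i + d : ℕ) ?_
      rw [h]
      push_cast
      ring
    rw [h, stepFourPerm, Equiv.Perm.mul_apply, formPerm_four_mul_add_of_ne h4 (by norm_num) hc
      (hodd 1).symm, formPerm_four_mul_add_of_ne h4 (by norm_num) hc (hodd 0).symm]
  · obtain ⟨i, c, hc, hi, h⟩ := exists_eq_four_mul_add h4 (2 * t + 1)
    have heven : ∀ d, c ≠ 2 * d := by
      rintro d rfl
      refine ZMod.two_mul_ne_two_mul_add_one h2 (2 * i + d : ℕ) t ?_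
      rw [h]
      push_cast
      ring
    have h0 := heven 0
    have h2 := heven 1
    obtain rfl | rfl : c = 1 ∨ c = 3 := by omega
    · rw [h, stepFourPerm, Equiv.Perm.mul_apply, formPerm_four_mul_add_of_ne h4 (by norm_num) hc
        (by norm_num), formPerm_four_mul_add h4 hc hi]
    -- The shifted point must again be shown to be `3` mod `4`, so that the other cycle fixes it; no
    -- bound on `i + 1` is needed for that.
    · have h5 : ((4 * i + 3 : ℕ) : ZMod n) + 4 = ((4 * (i + 1) + 3 : ℕ) : ZMod n) := by
        push_cast
        ring
      rw [h, stepFourPerm, Equiv.Perm.mul_apply, formPerm_four_mul_add h4 hc hi, h5,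
        formPerm_four_mul_add_of_ne h4 (by norm_num) hc (by norm_num)]

theorem stepFourPerm_mem_fixSubgroup {n : ℕ} [NeZero n] (h4 : 4 ∣ n) :
    stepFourPerm n ∈ fixSubgroup n := by
  have h := (stepFourPerm_apply h4 (0 : ZMod n)).1
  rw [mul_zero] at h
  exact h

theorem stepFourPerm_commute {n : ℕ} [NeZero n] (h4 : 4 ∣ n) :
    Commute (stepFourPerm n) (stdCycle n ^ 2) := by
  refine Equiv.ext fun m => ?_
  have h : ∀ m, (stdCycle n ^ 2) m = m + 2 := fun m => by
    have := stdCycle_zpow_apply n 2 m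
    norm_cast at this
  rw [Equiv.Perm.mul_apply, Equiv.Perm.mul_apply, h, h]
  obtain ⟨t, rfl | rfl⟩ := ZMod.eq_two_mul_or m
  · rw [(stepFourPerm_apply h4 t).1, show 2 * t + 2 = 2 * (t + 1) by ring,
      (stepFourPerm_apply h4 (t + 1)).1]
  · rw [(stepFourPerm_apply h4 t).2, show 2 * t + 1 + 2 = 2 * (t + 1) + 1 by ring,
      (stepFourPerm_apply h4 (t + 1)).2]
    ring

/-- Since `a` switches parity, exactly one of the two factors `x` contributes its shift by `4`. -/
theorem stepFourPerm_mul_stdCycle_mul {n : ℕ} [NeZero n] (h4 : 4 ∣ n) :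
    stepFourPerm n * stdCycle n * stepFourPerm n = stdCycle n ^ 5 := by
  refine Equiv.ext fun m => ?_
  have h5 : (stdCycle n ^ 5) m = m + 5 := by
    have := stdCycle_zpow_apply n 5 m
    norm_cast at this
  have h1 : ∀ m, stdCycle n m = m + 1 := fun m => rfl
  rw [Equiv.Perm.mul_apply, Equiv.Perm.mul_apply, h1, h5]
  obtain ⟨t, rfl | rfl⟩ := ZMod.eq_two_mul_or m
  · rw [(stepFourPerm_apply h4 t).1, (stepFourPerm_apply h4 t).2]
    ring
  · rw [(stepFourPerm_apply h4 t).2, show 2 * t + 1 + 4 + 1 = 2 * (t + 3) by ring,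
      (stepFourPerm_apply h4 (t + 3)).1]
    ring

theorem stepFourPerm_inv_ne {n : ℕ} [NeZero n] (h4 : 4 ∣ n) (hn : 12 ≤ n) :
    (stepFourPerm n)⁻¹ ≠ stepFourPerm n := by
  intro h
  have h1 : (stepFourPerm n) (stepFourPerm n 1) = 1 :=
    Equiv.congr_fun (inv_eq_iff_mul_eq_one.mp h) 1
  have h2 : (1 : ZMod n) = 2 * 0 + 1 := by ring
  have h3 : (2 * 0 + 1 + 4 : ZMod n) = 2 * 2 + 1 := by ring
  rw [h2, (stepFourPerm_apply h4 _).2, h3, (stepFourPerm_apply h4 _).2] at h1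
  -- `x ^ 2` sends `1` to `9`, so an involution would force `n ∣ 8`.
  have h4 : ((8 : ℕ) : ZMod n) = 0 := by
    push_cast
    linear_combination h1
  rw [ZMod.natCast_eq_zero_iff] at h4
  have := Nat.le_of_dvd (by norm_num) h4
  omega

/-! ### The cyclic group generated by `a` -/

theorem orderOf_stdCycle (n : ℕ) : orderOf (stdCycle n) = n := by
  refine Nat.dvd_antisymm ?_ ?_
  · rw [orderOf_dvd_iff_pow_eq_one]
    refine Equiv.ext fun m => ?_
    have := stdCycle_zpow_apply n n m
    simpa using this
  · have h := stdCycle_zpow_apply n (orderOf (stdCycle n)) 0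
    rw [zpow_natCast, pow_orderOf_eq_one] at h
    simpa [ZMod.natCast_eq_zero_iff, eq_comm] using h

theorem orderOf_cyclicGen (n : ℕ) : orderOf (cyclicGen n) = n := by
  rw [← orderOf_stdCycle n, ← Subgroup.orderOf_coe]
  simp only [cyclicGen, orderOf_stdCycle]

theorem card_cyclicSubgroup (n : ℕ) : Nat.card (cyclicSubgroup n) = n := by
  rw [Nat.card_zpowers, orderOf_stdCycle]

theorem mem_zpowers_cyclicGen (n : ℕ) (b : cyclicSubgroup n) :
    b ∈ Subgroup.zpowers (cyclicGen n) := by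
  obtain ⟨_, i, rfl⟩ := b
  exact ⟨i, rfl⟩

/-- The permutation `(1 5 9 ⋯ n-3)(3 7 11 ⋯ n-1)` as an element of `S_{n-1}`. -/
def stepFour {n : ℕ} [NeZero n] (h4 : 4 ∣ n) : fixSubgroup n :=
  ⟨stepFourPerm n, stepFourPerm_mem_fixSubgroup h4⟩

/-! ### Matched-pair action on `x` and `x⁻¹`, and the stabilizer -/

section

variable {n : ℕ} [NeZero n] (h4 : 4 ∣ n)

theorem act_stepFour_even (i : ℤ) :
    (symMatchedPair n).lact (stepFour h4) (cyclicGen n ^ (2 * i)) = cyclicGen n ^ (2 * i) ∧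
    (symMatchedPair n).ract (stepFour h4) (cyclicGen n ^ (2 * i)) = stepFour h4 := by
  refine MatchedPair.ofIsComplement_apply (isComplement_cyclic_fix n) ?_
  have h := (stepFourPerm_commute h4).zpow_right i
  rw [← zpow_natCast, ← zpow_mul] at h
  exact h

theorem ract_stepFour_inv_even (i : ℤ) :
    (symMatchedPair n).ract (stepFour h4)⁻¹ (cyclicGen n ^ (2 * i)) = (stepFour h4)⁻¹ := by
  obtain ⟨h1, h2⟩ := act_stepFour_even h4 i
  have h3 := (symMatchedPair n).inv_ract (stepFour h4) (cyclicGen n ^ (2 * i))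
  rw [h1, h2] at h3
  exact h3.symm

theorem act_stepFour_odd (i : ℤ) :
    (symMatchedPair n).lact (stepFour h4) (cyclicGen n ^ (2 * i + 1)) =
      cyclicGen n ^ (2 * i + 5) ∧
    (symMatchedPair n).ract (stepFour h4) (cyclicGen n ^ (2 * i + 1)) = (stepFour h4)⁻¹ := by
  refine MatchedPair.ofIsComplement_apply (isComplement_cyclic_fix n) ?_
  have h := (stepFourPerm_commute h4).zpow_right i
  rw [← zpow_natCast, ← zpow_mul, Nat.cast_ofNat] at h
  change stepFourPerm n * stdCycle n ^ (2 * i + 1) =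
    stdCycle n ^ (2 * i + 5) * (stepFourPerm n)⁻¹
  have h5 := stepFourPerm_mul_stdCycle_mul h4
  rw [eq_mul_inv_iff_mul_eq, zpow_add, zpow_add, zpow_one, ← mul_assoc, h.eq, mul_assoc, mul_assoc,
    ← mul_assoc (stepFourPerm n), h5]
  rfl

/-- Inverts `act_stepFour_odd`; the shift to `i - 2` compensates for the `4` added to the exponent
there. -/
theorem act_stepFour_inv_odd (i : ℤ) :
    (symMatchedPair n).lact (stepFour h4)⁻¹ (cyclicGen n ^ (2 * i + 1)) =
      cyclicGen n ^ (2 * i - 3) ∧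
    (symMatchedPair n).ract (stepFour h4)⁻¹ (cyclicGen n ^ (2 * i + 1)) = stepFour h4 := by
  obtain ⟨h1, h2⟩ := act_stepFour_odd h4 (i - 2)
  have h3 := (symMatchedPair n).mul_lact (stepFour h4)⁻¹ (stepFour h4)
    (cyclicGen n ^ (2 * (i - 2) + 1))
  have h5 := (symMatchedPair n).inv_ract (stepFour h4) (cyclicGen n ^ (2 * (i - 2) + 1))
  rw [inv_mul_cancel, MatchedPair.one_lact, h1] at h3
  rw [h1, h2, inv_inv] at h5
  rw [show 2 * i + 1 = 2 * (i - 2) + 5 by ring, show 2 * i - 3 = 2 * (i - 2) + 1 by ring]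
  exact ⟨h3.symm, h5.symm⟩

theorem stepFour_inv_ne (hn : 12 ≤ n) : (stepFour h4)⁻¹ ≠ stepFour h4 := fun h =>
  stepFourPerm_inv_ne h4 hn (congrArg Subtype.val h)

theorem stab_stepFour (hn : 12 ≤ n) :
    (symMatchedPair n).stab (stepFour h4) = Subgroup.zpowers (cyclicGen n ^ 2) := by
  refine le_antisymm (fun b hb => ?_) (Subgroup.zpowers_le.mpr ?_)
  · obtain ⟨i, rfl⟩ := mem_zpowers_cyclicGen n b
    obtain ⟨j, rfl | rfl⟩ := Int.even_or_odd' i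
    · refine ⟨j, ?_⟩
      simp only [zpow_mul]
      rfl
    · exact absurd ((act_stepFour_odd h4 j).2.symm.trans hb) (stepFour_inv_ne h4 hn)
  · have h := (act_stepFour_even h4 1).2
    exact_mod_cast h

theorem card_stab_stepFour (hn : 12 ≤ n) :
    Nat.card ((symMatchedPair n).stab (stepFour h4)) = n / 2 := by
  have h2 : 2 ∣ n := Dvd.dvd.trans (by norm_num) h4
  rw [stab_stepFour h4 hn, Nat.card_zpowers, orderOf_pow_of_dvd two_ne_zero
    (by rwa [orderOf_cyclicGen]), orderOf_cyclicGen]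

theorem index_stab_stepFour (hn : 12 ≤ n) :
    ((symMatchedPair n).stab (stepFour h4)).index = 2 := by
  have h := Subgroup.card_mul_index ((symMatchedPair n).stab (stepFour h4))
  rw [card_stab_stepFour h4 hn, card_cyclicSubgroup] at h
  obtain ⟨m, rfl⟩ := h4
  rw [show 4 * m / 2 = 2 * m by omega] at h
  refine Nat.eq_of_mul_eq_mul_left (show 0 < 2 * m by omega) ?_
  rw [h]
  ring

end

/-! ### The indicator of the induced module -/

section

variable {n : ℕ} [NeZero n] (h4 : 4 ∣ n) {k : Type w} [Field k]
variable {ρ : Representation k ((symMatchedPair n).stab (stepFour h4)) k}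
variable (ha : cyclicGen n ^ 2 ∈ (symMatchedPair n).stab (stepFour h4))

/-- An odd power of `a ^ 2` moves across the tensor sign and acts there as an odd power of `-1`. -/
theorem inducedTmul_mul_odd (hρ : ∀ v, ρ ⟨cyclicGen n ^ 2, ha⟩ v = -v) (c : cyclicSubgroup n)
    (m : ℤ) (v : k) :
    (symMatchedPair n).inducedTmul (stepFour h4) ρ (c * cyclicGen n ^ (2 * (2 * m + 1))) v =
      -(symMatchedPair n).inducedTmul (stepFour h4) ρ c v := by
  have h1 : ρ ((⟨cyclicGen n ^ 2, ha⟩ : (symMatchedPair n).stab (stepFour h4)) ^ (2 * m)) = 1 := by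
    rw [zpow_mul]
    -- Endomorphisms form only a monoid, so integer powers are handled through the kernel of the
    -- induced homomorphism to units.
    have h2 : (⟨cyclicGen n ^ 2, ha⟩ : (symMatchedPair n).stab (stepFour h4)) ^ (2 : ℤ) ∈
        (MonoidHom.toHomUnits ρ).ker := by
      rw [MonoidHom.mem_ker]
      refine Units.ext (LinearMap.ext fun v => ?_)
      change ρ (_ ^ (2 : ℤ)) v = v
      rw [zpow_two, map_mul, Module.End.mul_apply, hρ, hρ, neg_neg]
    exact congrArg Units.val (MonoidHom.mem_ker.mp (Subgroup.zpow_mem _ h2 m))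
  have h3 := (symMatchedPair n).inducedTmul_mul (stepFour h4) ρ c
    (⟨cyclicGen n ^ 2, ha⟩ ^ (2 * m + 1)) v
  rw [zpow_add, map_mul, h1, one_mul, zpow_one, hρ, map_neg] at h3
  rw [← h3]
  congr 3
  rw [zpow_mul, zpow_add, zpow_one]
  rfl

open Classical in
theorem mul_comul_smul_tmul_stepFour (hn : 12 ≤ n)
    (hρ : ∀ v, ρ ⟨cyclicGen n ^ 2, ha⟩ v = -v) (b c : cyclicSubgroup n) (v : k) :
    LinearMap.mul' k (BismashSym k n) (Coalgebra.comul (R := k)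
      (MatchedPair.Bismash.basisElt (symMatchedPair n) k 1 b)) •
      (symMatchedPair n).inducedTmul (stepFour h4) ρ c v =
      if b ∈ (symMatchedPair n).stab (stepFour h4) then 0 else
        -(symMatchedPair n).inducedTmul (stepFour h4) ρ c v := by
  have hne := stepFour_inv_ne h4 hn
  rw [MatchedPair.mul_comul_smul_tmul, MatchedPair.mem_stab]
  obtain ⟨i, rfl⟩ := mem_zpowers_cyclicGen n c
  obtain ⟨j, rfl⟩ := mem_zpowers_cyclicGen n b
  dsimp only
  obtain ⟨i, rfl | rfl⟩ := Int.even_or_odd' i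
  · have hc : (cyclicGen n ^ (2 * i))⁻¹ = cyclicGen n ^ (2 * -i) := by
      rw [← zpow_neg]
      ring_nf
    rw [hc, (act_stepFour_even h4 (-i)).2]
    obtain ⟨j, rfl | rfl⟩ := Int.even_or_odd' j
    · rw [ract_stepFour_inv_even, if_neg hne, (act_stepFour_even h4 j).2, if_pos rfl]
    -- Here `y = x⁻¹` and `(y ▷ b) b = a^(4j-2) = a^(2(2(j-1)+1))`.
    · rw [(act_stepFour_inv_odd h4 j).2, if_pos rfl, (act_stepFour_odd h4 j).2, if_neg hne,
        (act_stepFour_inv_odd h4 j).1, ← inducedTmul_mul_odd h4 ha hρ _ (j - 1), ← zpow_add,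
        ← zpow_add, ← zpow_add]
      congr 3
      ring
  · have hc : (cyclicGen n ^ (2 * i + 1))⁻¹ = cyclicGen n ^ (2 * (-i - 1) + 1) := by
      rw [← zpow_neg]
      ring_nf
    rw [hc, (act_stepFour_odd h4 _).2, inv_inv]
    obtain ⟨j, rfl | rfl⟩ := Int.even_or_odd' j
    · rw [(act_stepFour_even h4 j).2, if_neg hne.symm, if_pos rfl]
    -- Here `y = x` and `(y ▷ b) b = a^(4j+6) = a^(2(2(j+1)+1))`.
    · rw [(act_stepFour_odd h4 j).2, if_pos rfl, if_neg hne,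
        (act_stepFour_odd h4 j).1, ← inducedTmul_mul_odd h4 ha hρ _ (j + 1), ← zpow_add,
        ← zpow_add, ← zpow_add]
      congr 3
      ring

theorem hasIndicator_induced_stepFour [CharZero k] (hn : 12 ≤ n)
    (hρ : ∀ v, ρ ⟨cyclicGen n ^ 2, ha⟩ v = -v) :
    HasIndicator k (BismashSym k n) ((symMatchedPair n).Induced (stepFour h4) ρ) (-1) := by
  classical
  have hcard : Fintype.card (cyclicSubgroup n) = n := by
    rw [← Nat.card_eq_fintype_card, card_cyclicSubgroup]
  have hn0 : (n : k) ≠ 0 := NeZero.ne _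
  have hrank : Module.finrank k ((symMatchedPair n).Induced (stepFour h4) ρ) = 2 := by
    rw [MatchedPair.finrank_induced, index_stab_stepFour h4 hn]
  have : Module.Finite k ((symMatchedPair n).Induced (stepFour h4) ρ) :=
    Module.finite_of_finrank_eq_succ hrank
  have hfilter : ((Finset.univ.filter fun b : cyclicSubgroup n =>
      b ∉ (symMatchedPair n).stab (stepFour h4)).card : k) = n / 2 := by
    have h1 := Finset.card_filter_add_card_filter_not (s := Finset.univ)
      (fun b : cyclicSubgroup n => b ∈ (symMatchedPair n).stab (stepFour h4))
    have h2 := card_stab_stepFour h4 hn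
    rw [Nat.card_eq_fintype_card, Fintype.card_subtype] at h2
    rw [h2, Finset.card_univ, hcard] at h1
    have h3 : 2 * (Finset.univ.filter fun b : cyclicSubgroup n =>
      b ∉ (symMatchedPair n).stab (stepFour h4)).card = n := by omega
    rw [eq_div_iff two_ne_zero, mul_comm]
    exact_mod_cast h3
  have key := hasIndicator_of_lsmul_eq k ((symMatchedPair n).Induced (stepFour h4) ρ)
    (MatchedPair.Bismash.isNormalizedIntegral_integral (symMatchedPair n) k (by rwa [hcard]))
    -- The scalar is `n⁻¹` times `-1` for each of the `n / 2` elements outside the stabilizer.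
    (-(1 / 2)) ?_
  · rw [hrank] at key
    convert key using 1
    norm_num
  · refine (symMatchedPair n).induced_hom_ext _ _ fun c v => ?_
    rw [Algebra.lsmul_coe, LinearMap.smul_apply, LinearMap.id_apply, MatchedPair.Bismash.integral,
      map_smul, map_smul, map_sum, map_sum]
    beta_reduce
    rw [smul_assoc, Finset.sum_smul]
    simp only [mul_comul_smul_tmul_stepFour h4 ha hn hρ]
    rw [Finset.sum_ite, Finset.sum_const_zero, zero_add, Finset.sum_const,
      ← Nat.cast_smul_eq_nsmul k, hfilter, smul_smul, hcard, smul_neg, neg_smul]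
    congr 2
    field_simp

theorem exists_representation_stab_stepFour (hn : 12 ≤ n) :
    ∃ (ha : cyclicGen n ^ 2 ∈ (symMatchedPair n).stab (stepFour h4))
      (ρ : Representation k ((symMatchedPair n).stab (stepFour h4)) k),
      ∀ v, ρ ⟨cyclicGen n ^ 2, ha⟩ v = -v := by
  have hs := stab_stepFour h4 hn
  have ha : cyclicGen n ^ 2 ∈ (symMatchedPair n).stab (stepFour h4) := by
    rw [hs]
    exact Subgroup.mem_zpowers _
  have hg : ∀ b : (symMatchedPair n).stab (stepFour h4),
      b ∈ Subgroup.zpowers (⟨cyclicGen n ^ 2, ha⟩ : (symMatchedPair n).stab (stepFour h4)) := by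
    rintro ⟨b, hb⟩
    have hb' := hb
    rw [hs] at hb'
    obtain ⟨i, hi⟩ := hb'
    exact ⟨i, Subtype.ext hi⟩
  have hord : orderOf (-1 : kˣ) ∣
      orderOf (⟨cyclicGen n ^ 2, ha⟩ : (symMatchedPair n).stab (stepFour h4)) := by
    -- A character with value `-1` on the generator exists because the stabilizer is cyclic of order
    -- `n / 2`, which is even as `4 ∣ n`.
    refine (orderOf_dvd_of_pow_eq_one (n := 2) (by simp)).trans ?_
    rw [orderOf_eq_card_of_forall_mem_zpowers hg, card_stab_stepFour h4 hn]
    omega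
  refine ⟨ha, (Algebra.lmul k k : k →* Module.End k k).comp
    ((Units.coeHom k).comp (monoidHomOfForallMemZpowers hg hord)), fun v => ?_⟩
  change ((monoidHomOfForallMemZpowers hg hord _ : kˣ) : k) * v = -v
  rw [monoidHomOfForallMemZpowers_apply_gen]
  simp

end

end

theorem mainTheorem5 (k : Type*) [Field k] [IsAlgClosed k] [CharZero k] (n : ℕ) [NeZero n]
    (h4 : 4 ∣ n) (hn : 12 ≤ n) (ζ : k) (hζ : IsPrimitiveRoot ζ (n / 2)) :
    ∃ x : fixSubgroup n, (x : Equiv.Perm (ZMod n)) = stepFourPerm n ∧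
      (symMatchedPair n).stab x = Subgroup.zpowers (cyclicGen n ^ 2) ∧
      ∃ (ha : cyclicGen n ^ 2 ∈ (symMatchedPair n).stab x)
        (ρ : Representation k ((symMatchedPair n).stab x) k),
        (∀ v : k, ρ ⟨cyclicGen n ^ 2, ha⟩ v = ζ ^ (n / 4) * v) ∧
        IsSimpleModule (BismashSym k n) ((symMatchedPair n).Induced x ρ) ∧
        Module.finrank k ((symMatchedPair n).Induced x ρ) = 2 ∧
        HasIndicator k (BismashSym k n) ((symMatchedPair n).Induced x ρ) (-1) := by
  -- As `n / 2 = n / 4 * 2`, this power is a primitive square root of unity.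
  have hζ' : ζ ^ (n / 4) = -1 :=
    (hζ.pow (by omega) (show n / 2 = n / 4 * 2 by omega)).eq_neg_one_of_two_right
  obtain ⟨ha, ρ, hρ⟩ := exists_representation_stab_stepFour h4 (k := k) hn
  refine ⟨stepFour h4, rfl, stab_stepFour h4 hn, ha, ρ, fun v => ?_,
    MatchedPair.isSimpleModule_induced _ _ ρ, ?_, hasIndicator_induced_stepFour h4 ha hn hρ⟩
  · rw [hρ, hζ', neg_one_mul]
  · rw [MatchedPair.finrank_induced, index_stab_stepFour h4 hn]
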